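/- Call a sequence $(P_n)_{n\ge 0}$ of complex polynomials, with $P_n$ monic of degree $n$, *$2$-orthogonal* if there are two complex Borel measures $\mu_0,\mu_1$ on $\mathbb{C}$ having finite moments of all orders such that, for every integer $k\ge 0$, $$\int x^kP_n(x)\,\mathrm{d}\mu_0(x)=0 \ \text{ if } n\ge 2k+1,\qquad \int x^kP_{2k}(x)\,\mathrm{d}\mu_0(x)\neq 0,$$ $$\int x^kP_n(x)\,\mathrm{d}\mu_1(x)=0 \ \text{ if } n\ge 2k+2,\qquad \int x^kP_{2k+1}(x)\,\mathrm{d}\mu_1(x)\neq 0 .$$ (Equivalently, such conditions hold for two linear functionals on $\mathbb{C}[x]$ in place of the two measures.) Call $(P_n)_{n\ge0}$ *Hahn-classical* if both $(P_n)_{n\ge0}$ and the sequence of monic derivatives $\left(\frac{1}{n+1}P_{n+1}'\right)_{n\ge0}$ are $2$-orthogonal. Call it *$3$-fold symmetric* if, for all $n\ge 0$, $$P_n\left(e^{2\pi i/3}x\right)=e^{2n\pi i/3}P_n(x)\quad\text{and}\quad P_n\left(e^{4\pi i/3}x\right)=e^{4n\pi i/3}P_n(x).$$ **Theorem.** Let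 $(P_n)_{n\ge0}$ be a $3$-fold symmetric Hahn-classical $2$-orthogonal polynomial sequence. Then there are polynomial sequences $(P_n^{[k]})_{n\ge0}$, $k\in\{0,1,2\}$ (the cubic components of $(P_n)$), with $$P_{3n+k}(x)=x^kP_n^{[k]}(x^3)\quad\text{for all } n\ge 0,$$ and, for each $k\in\{0,1,2\}$, the sequence $(P_n^{[k]})_{n\ge0}$ is Hahn-classical. -/

import Mathlib

open Polynomial MeasureTheory

namespace TwoOrthogonal

/-- A monic polynomial sequence: `P n` is monic of degree exactly `n`. -/
def IsMonicSequence (P : ℕ → ℂ[X]) : Prop :=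
  ∀ n, (P n).Monic ∧ (P n).natDegree = n

/-- The (complex) measure `w(x) dμ(x)` on `ℂ` has finite moments of every order. -/
def HasMoments (μ : Measure ℂ) (w : ℂ → ℂ) : Prop :=
  ∀ k : ℕ, Integrable (fun x : ℂ => x ^ k * w x) μ

/-- The monic sequence `P` is 2-orthogonal with respect to the pair of complex measures
`dμ₀ = w₀ dμ`, `dμ₁ = w₁ dμ`:
`∫ xᵏ Pₙ dμ₀ = 0` for `n ≥ 2k+1`, `∫ xᵏ P₂ₖ dμ₀ ≠ 0`,
`∫ xᵏ Pₙ dμ₁ = 0` for `n ≥ 2k+2`, `∫ xᵏ P₂ₖ₊₁ dμ₁ ≠ 0`. -/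
structure IsTwoOrthogonalWrt (μ : Measure ℂ) (w₀ w₁ : ℂ → ℂ) (P : ℕ → ℂ[X]) : Prop where
  monic : IsMonicSequence P
  moments₀ : HasMoments μ w₀
  moments₁ : HasMoments μ w₁
  ortho₀ : ∀ k n : ℕ, 2 * k + 1 ≤ n → ∫ x, x ^ k * (P n).eval x * w₀ x ∂μ = 0
  regular₀ : ∀ k : ℕ, ∫ x, x ^ k * (P (2 * k)).eval x * w₀ x ∂μ ≠ 0
  ortho₁ : ∀ k n : ℕ, 2 * k + 2 ≤ n → ∫ x, x ^ k * (P n).eval x * w₁ x ∂μ = 0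
  regular₁ : ∀ k : ℕ, ∫ x, x ^ k * (P (2 * k + 1)).eval x * w₁ x ∂μ ≠ 0

/-- `P` is a (monic) 2-orthogonal polynomial sequence. -/
def IsTwoOrthogonal (P : ℕ → ℂ[X]) : Prop :=
  ∃ (μ : Measure ℂ) (w₀ w₁ : ℂ → ℂ), IsTwoOrthogonalWrt μ w₀ w₁ P

/-- The monic sequence of derivatives `Q n = P' (n+1) / (n+1)`. -/
noncomputable def derivativeSequence (P : ℕ → ℂ[X]) (n : ℕ) : ℂ[X] :=
  C (1 / ((n : ℂ) + 1)) * derivative (P (n + 1))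

/-- Hahn's property: `P` is 2-orthogonal and so is the sequence of its derivatives. -/
def IsHahnClassical (P : ℕ → ℂ[X]) : Prop :=
  IsTwoOrthogonal P ∧ IsTwoOrthogonal (derivativeSequence P)

/-- 3-fold symmetry: `Pₙ(ω x) = ωⁿ Pₙ(x)` and `Pₙ(ω² x) = ω²ⁿ Pₙ(x)`, `ω = exp(2πi/3)`. -/
def IsThreefoldSymmetric (P : ℕ → ℂ[X]) : Prop :=
  ∀ (n : ℕ) (x : ℂ),
    (P n).eval (Complex.exp (2 * Real.pi * Complex.I / 3) * x) =
      Complex.exp (2 * n * Real.pi * Complex.I / 3) * (P n).eval x ∧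
    (P n).eval (Complex.exp (4 * Real.pi * Complex.I / 3) * x) =
      Complex.exp (4 * n * Real.pi * Complex.I / 3) * (P n).eval x

/-- `R 0`, `R 1`, `R 2` are the cubic components of `P`:
`P_{3n+k}(x) = xᵏ R_k,n(x³)`. -/
def IsCubicDecomposition (P : ℕ → ℂ[X]) (R : Fin 3 → ℕ → ℂ[X]) : Prop :=
  ∀ (k : Fin 3) (n : ℕ), P (3 * n + (k : ℕ)) = X ^ (k : ℕ) * (R k n).comp (X ^ 3)

/-! Every pair of linear functionals on polynomials is given by a pair of complex measures with
finite moments (superpose densities `aₙ z⁻ⁿ / 2π` on circles of rapidly growing radius), hence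
2-orthogonality can equivalently be tested with linear functionals. -/

lemma circle_moment (k n : ℕ) {r : ℝ} (hr : 0 < r) (a : ℂ) :
    ∫ θ in Set.Ioc 0 (2 * Real.pi),
      (circleMap 0 r θ) ^ k * (a / (2 * Real.pi) / (circleMap 0 r θ) ^ n)
      = if k = n then a else 0 := by
  have hpi : (Real.pi : ℂ) ≠ 0 := by exact_mod_cast Real.pi_ne_zero
  have hc : ∀ θ, circleMap 0 r θ ≠ 0 := fun θ => circleMap_ne_center hr.ne'
  rw [← intervalIntegral.integral_of_le (by positivity)]
  split_ifs with h
  · subst h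
    have : ∀ θ : ℝ, (circleMap 0 r θ) ^ k * (a / (2 * Real.pi) / (circleMap 0 r θ) ^ k)
        = a / (2 * Real.pi) := fun θ => by
      have := hc θ
      field_simp
    simp only [this, intervalIntegral.integral_const]
    rw [Complex.real_smul]
    push_cast
    field_simp
    simp
  · have : ∀ θ : ℝ, (circleMap 0 r θ) ^ k * (a / (2 * Real.pi) / (circleMap 0 r θ) ^ n)
        = (a / (2 * Real.pi) * (r : ℂ) ^ ((k : ℤ) - n))
          * Complex.exp ((((k : ℤ) - n : ℤ) : ℂ) * Complex.I * θ) := fun θ => by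
      have h1 : (circleMap 0 r θ) ^ k * (a / (2 * Real.pi) / (circleMap 0 r θ) ^ n)
        = a / (2 * Real.pi) * (circleMap 0 r θ) ^ ((k : ℤ) - n) := by
        rw [zpow_sub₀ (hc θ)]; simp; ring
      rw [h1, circleMap_zero, mul_zpow, ← Complex.exp_int_mul]
      push_cast
      ring_nf
    have hm : ((k : ℤ) - n : ℤ) ≠ 0 := by omega
    have hm' : (((k : ℤ) - n : ℤ) : ℂ) * Complex.I ≠ 0 :=
      mul_ne_zero (by exact_mod_cast hm) Complex.I_ne_zero
    simp only [this]
    rw [intervalIntegral.integral_const_mul, integral_exp_mul_complex hm']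
    have : Complex.exp ((((k : ℤ) - n : ℤ) : ℂ) * Complex.I * ((2 * Real.pi : ℝ) : ℂ)) = 1 := by
      rw [Complex.exp_eq_one_iff]
      exact ⟨(k : ℤ) - n, by push_cast; ring⟩
    rw [this]
    simp

noncomputable def radius (c d : ℕ → ℂ) (n : ℕ) : ℝ :=
  ∑ i ∈ Finset.range (n + 1), (2 + ‖c i‖ + ‖d i‖)

noncomputable def circleMeasure (r : ℝ) : Measure ℂ :=
  (volume.restrict (Set.Ioc 0 (2 * Real.pi))).map (circleMap 0 r)

noncomputable def circleWeight (c : ℕ → ℂ) (R : ℕ → ℝ) (z : ℂ) : ℂ :=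
  c (Function.invFun R ‖z‖) / (2 * Real.pi) / z ^ (Function.invFun R ‖z‖)

lemma radius_strictMono (c d : ℕ → ℂ) : StrictMono (radius c d) := by
  refine strictMono_nat_of_lt_succ fun n => ?_
  unfold radius
  rw [Finset.sum_range_succ _ (n + 1)]
  have := norm_nonneg (c (n + 1))
  have := norm_nonneg (d (n + 1))
  linarith

lemma radius_ge (c d : ℕ → ℂ) (n : ℕ) : 2 + ‖c n‖ + ‖d n‖ ≤ radius c d n := by
  unfold radius
  exact Finset.single_le_sum (f := fun i => 2 + ‖c i‖ + ‖d i‖)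
    (fun i _ => by positivity) (Finset.self_mem_range_succ n)

lemma circle_exists (c : ℕ → ℂ) (R : ℕ → ℝ) (hR : StrictMono R) (h2 : ∀ n, 2 ≤ R n)
    (hc : ∀ n, ‖c n‖ ≤ R n) :
    HasMoments (Measure.sum fun n => circleMeasure (R n)) (circleWeight c R) ∧
    ∀ k : ℕ, ∫ z, z ^ k * circleWeight c R z ∂(Measure.sum fun n => circleMeasure (R n)) = c k := by
  have hpos : ∀ n, 0 < R n := fun n => by linarith [h2 n]
  have hmc : ∀ n, Measurable (circleMap 0 (R n)) := fun n => (continuous_circleMap _ _).measurable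
  -- replace the weight on a single circle by a globally measurable function
  have hae : ∀ k n, (fun z : ℂ => z ^ k * circleWeight c R z)
      =ᵐ[circleMeasure (R n)] fun z => z ^ k * (c n / (2 * Real.pi) / z ^ n) := fun k n => by
    have hS : MeasurableSet (Metric.sphere (0 : ℂ) (R n)) := Metric.isClosed_sphere.measurableSet
    have h1 : ∀ᵐ z ∂circleMeasure (R n), z ∈ Metric.sphere (0 : ℂ) (R n) := by
      refine (ae_map_iff (hmc n).aemeasurable hS).2 ?_
      exact Filter.Eventually.of_forall fun θ => circleMap_mem_sphere _ (hpos n).le θ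
    filter_upwards [h1] with z hz
    have : Function.invFun R ‖z‖ = n := by
      rw [mem_sphere_zero_iff_norm.1 hz]
      exact Function.leftInverse_invFun hR.injective n
    simp only [circleWeight, this]
  have hmeas : ∀ k n, Measurable fun z : ℂ => z ^ k * (c n / (2 * Real.pi) / z ^ n) := fun k n => by
    fun_prop
  have hcomp : ∀ k n, Integrable
      ((fun z : ℂ => z ^ k * (c n / (2 * Real.pi) / z ^ n)) ∘ circleMap 0 (R n))
      (volume.restrict (Set.Ioc 0 (2 * Real.pi))) := fun k n => by
    have hcont : Continuous
        ((fun z : ℂ => z ^ k * (c n / (2 * Real.pi) / z ^ n)) ∘ circleMap 0 (R n)) := by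
      have h0 : ∀ θ, (circleMap 0 (R n) θ) ^ n ≠ 0 := fun θ =>
        pow_ne_zero _ (circleMap_ne_center (hpos n).ne')
      have hcm := continuous_circleMap 0 (R n)
      exact (hcm.pow k).mul (continuous_const.div (hcm.pow n) h0)
    exact (hcont.integrableOn_Icc).mono_set Set.Ioc_subset_Icc_self
  have hint : ∀ k n, Integrable (fun z : ℂ => z ^ k * circleWeight c R z) (circleMeasure (R n)) :=
    fun k n => by
      rw [integrable_congr (hae k n), circleMeasure,
        integrable_map_measure (hmeas k n).aestronglyMeasurable (hmc n).aemeasurable]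
      exact hcomp k n
  have hval : ∀ k n, ∫ z, z ^ k * circleWeight c R z ∂(circleMeasure (R n))
      = if k = n then c n else 0 := fun k n => by
    rw [integral_congr_ae (hae k n), circleMeasure,
      integral_map (hmc n).aemeasurable (hmeas k n).aestronglyMeasurable]
    exact circle_moment k n (hpos n) (c n)
  have hnorm : ∀ k n, ∫ z, ‖z ^ k * circleWeight c R z‖ ∂(circleMeasure (R n))
      = ‖c n‖ * (R n ^ k / R n ^ n) := fun k n => by
    have hae' : (fun z : ℂ => ‖z ^ k * circleWeight c R z‖)
        =ᵐ[circleMeasure (R n)] fun z => ‖z ^ k * (c n / (2 * Real.pi) / z ^ n)‖ :=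
      (hae k n).fun_comp norm
    rw [integral_congr_ae hae', circleMeasure,
      integral_map (hmc n).aemeasurable (hmeas k n).norm.aestronglyMeasurable]
    have hp := Real.pi_pos
    simp only [norm_mul, norm_div, norm_pow, norm_circleMap_zero, abs_of_pos (hpos n),
      Complex.norm_real, Complex.norm_ofNat, Real.norm_eq_abs, abs_of_pos hp]
    rw [setIntegral_const]
    simp [Measure.real]
    rw [ENNReal.toReal_ofReal hp.le]
    field_simp
  have hI : HasMoments (Measure.sum fun n => circleMeasure (R n)) (circleWeight c R) := by
    intro k
    refine integrable_sum_measure (hint k) ?_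
    simp only [hnorm]
    rw [← summable_nat_add_iff (k + 1)]
    refine Summable.of_nonneg_of_le (fun n => ?_) (fun n => ?_)
      (summable_geometric_of_lt_one (r := (1 / 2 : ℝ)) (by norm_num) (by norm_num))
    · have := hpos (n + (k + 1)); positivity
    · have h0 := hpos (n + (k + 1))
      set r := R (n + (k + 1)) with hr
      have e : r ^ k / r ^ (n + (k + 1)) = (1 / r) ^ n * (1 / r) := by
        rw [← pow_succ, one_div, inv_pow, ← one_div, div_eq_div_iff (by positivity) (by positivity)]
        ring
      rw [e]
      have h3 : (1 / r) ^ n ≤ (1 / 2 : ℝ) ^ n :=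
        pow_le_pow_left₀ (by positivity) (one_div_le_one_div_of_le (by norm_num) (h2 _)) n
      have h4 : ‖c (n + (k + 1))‖ * (1 / r) ≤ 1 := by
        rw [mul_one_div, div_le_one h0]; exact hc _
      calc ‖c (n + (k + 1))‖ * ((1 / r) ^ n * (1 / r))
          = (1 / r) ^ n * (‖c (n + (k + 1))‖ * (1 / r)) := by ring
        _ ≤ (1 / r) ^ n * 1 := by gcongr
        _ ≤ (1 / 2 : ℝ) ^ n := by simpa using h3
  refine ⟨hI, fun k => ?_⟩
  have hs := hasSum_integral_measure (hI k)
  simp only [hval] at hs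
  have h1 := hs.tsum_eq
  rw [← h1, tsum_eq_single k (fun n hn => if_neg (Ne.symm hn)), if_pos rfl]

/-- Integration of polynomials against `w dμ`, as a linear functional. -/
noncomputable def momentFunctional (μ : Measure ℂ) (w : ℂ → ℂ) (h : HasMoments μ w) :
    ℂ[X] →ₗ[ℂ] ℂ :=
  have hi : ∀ p : ℂ[X], Integrable (fun x => p.eval x * w x) μ := fun p => by
    simp only [eval_eq_sum_range, Finset.sum_mul, mul_assoc]
    exact integrable_finsetSum _ fun i _ => (h i).const_mul _
  { toFun := fun p => ∫ x, p.eval x * w x ∂μ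
    map_add' := fun p q => by
      simp only [eval_add, add_mul]
      exact integral_add (hi p) (hi q)
    map_smul' := fun a p => by
      simp only [eval_smul, smul_eq_mul, mul_assoc, RingHom.id_apply]
      exact integral_const_mul _ _ }

theorem exists_moments (u₀ u₁ : ℂ[X] →ₗ[ℂ] ℂ) :
    ∃ (μ : Measure ℂ) (w₀ w₁ : ℂ → ℂ) (h₀ : HasMoments μ w₀) (h₁ : HasMoments μ w₁),
      momentFunctional μ w₀ h₀ = u₀ ∧ momentFunctional μ w₁ h₁ = u₁ := by
  set c : ℕ → ℂ := fun n => u₀ (X ^ n)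
  set d : ℕ → ℂ := fun n => u₁ (X ^ n)
  have hge := radius_ge c d
  have hm := radius_strictMono c d
  have h2 : ∀ n, 2 ≤ radius c d n := fun n => by
    linarith [hge n, norm_nonneg (c n), norm_nonneg (d n)]
  obtain ⟨a₀, b₀⟩ := circle_exists c _ hm h2
    (fun n => by linarith [hge n, norm_nonneg (c n), norm_nonneg (d n)])
  obtain ⟨a₁, b₁⟩ := circle_exists d _ hm h2
    (fun n => by linarith [hge n, norm_nonneg (c n), norm_nonneg (d n)])
  refine ⟨_, _, _, a₀, a₁, ?_, ?_⟩
  · refine Polynomial.lhom_ext' fun n => LinearMap.ext_ring ?_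
    have := b₀ n
    simpa [momentFunctional, ← C_mul_X_pow_eq_monomial] using this
  · refine Polynomial.lhom_ext' fun n => LinearMap.ext_ring ?_
    have := b₁ n
    simpa [momentFunctional, ← C_mul_X_pow_eq_monomial] using this

/-- 2-orthogonality in terms of a pair of linear functionals. -/
theorem isTwoOrthogonal_iff_functionals (P : ℕ → ℂ[X]) :
    IsTwoOrthogonal P ↔ IsMonicSequence P ∧ ∃ u₀ u₁ : ℂ[X] →ₗ[ℂ] ℂ,
      (∀ k n : ℕ, 2 * k + 1 ≤ n → u₀ (X ^ k * P n) = 0) ∧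
      (∀ k : ℕ, u₀ (X ^ k * P (2 * k)) ≠ 0) ∧
      (∀ k n : ℕ, 2 * k + 2 ≤ n → u₁ (X ^ k * P n) = 0) ∧
      (∀ k : ℕ, u₁ (X ^ k * P (2 * k + 1)) ≠ 0) := by
  have key : ∀ (μ : Measure ℂ) (w : ℂ → ℂ) (h : HasMoments μ w) (k n : ℕ),
      momentFunctional μ w h (X ^ k * P n) = ∫ x, x ^ k * (P n).eval x * w x ∂μ := by
    intro μ w h k n
    simp [momentFunctional]
  constructor
  · rintro ⟨μ, w₀, w₁, hP⟩
    refine ⟨hP.monic, momentFunctional μ w₀ hP.moments₀, momentFunctional μ w₁ hP.moments₁, ?_⟩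
    simp only [key]
    exact ⟨hP.ortho₀, hP.regular₀, hP.ortho₁, hP.regular₁⟩
  · rintro ⟨hm, u₀, u₁, h⟩
    obtain ⟨μ, w₀, w₁, h₀, h₁, rfl, rfl⟩ := exists_moments u₀ u₁
    simp only [key] at h
    exact ⟨μ, w₀, w₁, hm, h₀, h₁, h.1, h.2.1, h.2.2.1, h.2.2.2⟩

end TwoOrthogonal

/-! Work with linear functionals: `u₀, u₁` for P and `v₀, v₁` for its monic derivatives. Write U₀ f
= u₀(f(x³)), U₁ f = u₁(x f(x³)), and V₀, V₁ likewise from `v₀`, `v₁`. Reading the conditions on P at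
indices 3n+k shows that the components R₀, R₁, R₂ are 2-orthogonal for (U₀, U₁), (U₁, xU₀), (xU₀,
xU₁).

For the derivatives the key is `exists_pearson`: V₀(x^{l+1} g') is a combination of U₁(x^l g) and
U₀(x^l g), and V₁(x^{l+1} g') one of U₀(x^{l+1} g) and U₁(x^l g), the first coefficient never
vanishing. Both follow because a functional killing all but the first one or two terms of a
2-orthogonal sequence lies in the span of the first one or two orthogonality functionals. By the
criterion `IsOrthogonalPair.derivativeSequence`, multiplying V₀ and V₁ by x or x² then gives
functionals for the derivatives of each component.

Symmetry serves only to produce the components: it forces the exponents in Pₙ to be congruent to n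
mod 3. -/

namespace TwoOrthogonal

/-- 2-orthogonality of a monic sequence with respect to two given linear functionals. -/
structure IsOrthogonalPair (u₀ u₁ : ℂ[X] →ₗ[ℂ] ℂ) (P : ℕ → ℂ[X]) : Prop where
  monic : IsMonicSequence P
  ortho₀ : ∀ k n : ℕ, 2 * k + 1 ≤ n → u₀ (X ^ k * P n) = 0
  regular₀ : ∀ k : ℕ, u₀ (X ^ k * P (2 * k)) ≠ 0
  ortho₁ : ∀ k n : ℕ, 2 * k + 2 ≤ n → u₁ (X ^ k * P n) = 0
  regular₁ : ∀ k : ℕ, u₁ (X ^ k * P (2 * k + 1)) ≠ 0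

lemma isTwoOrthogonal_iff_exists_pair (P : ℕ → ℂ[X]) :
    IsTwoOrthogonal P ↔ ∃ u₀ u₁ : ℂ[X] →ₗ[ℂ] ℂ, IsOrthogonalPair u₀ u₁ P := by
  rw [isTwoOrthogonal_iff_functionals]
  exact ⟨fun ⟨hm, u₀, u₁, h⟩ => ⟨u₀, u₁, hm, h.1, h.2.1, h.2.2.1, h.2.2.2⟩,
    fun ⟨u₀, u₁, h⟩ => ⟨h.monic, u₀, u₁, h.ortho₀, h.regular₀, h.ortho₁, h.regular₁⟩⟩

/-! ### Functionals determined by their values on a monic sequence -/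

/-- A linear functional that vanishes on a monic sequence is zero. -/
lemma IsMonicSequence.functional_eq_zero {P : ℕ → ℂ[X]} (hP : IsMonicSequence P)
    (w : ℂ[X] →ₗ[ℂ] ℂ) (hw : ∀ n, w (P n) = 0) (f : ℂ[X]) : w f = 0 := by
  suffices h : ∀ n : ℕ, ∀ f : ℂ[X], f.degree < n → w f = 0 from
    h (f.natDegree + 1) f (degree_le_natDegree.trans_lt (by exact_mod_cast Nat.lt_succ_self _))
  intro n
  induction n with
  | zero =>
    intro f hf
    have : f = 0 := by simpa using hf
    simp [this]
  | succ n ih =>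
    intro f hf
    have hdeg : (f - C (f.coeff n) * P n).degree < n := by
      rw [degree_lt_iff_coeff_zero]
      intro m hm
      rcases hm.eq_or_lt with rfl | hm
      · have h1 := (hP n).1.coeff_natDegree
        rw [(hP n).2] at h1
        simp [h1]
      · have h1 : f.coeff m = 0 := coeff_eq_zero_of_degree_lt
          (hf.trans_le (by exact_mod_cast hm))
        have h2 : (P n).coeff m = 0 := coeff_eq_zero_of_natDegree_lt (by rw [(hP n).2]; exact hm)
        simp [h1, h2]
    have h := ih _ hdeg
    rwa [← smul_eq_C_mul, map_sub, map_smul, hw, smul_zero, sub_zero] at h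

lemma IsOrthogonalPair.exists_eq_smul {u₀ u₁ : ℂ[X] →ₗ[ℂ] ℂ} {P : ℕ → ℂ[X]}
    (h : IsOrthogonalPair u₀ u₁ P) (w : ℂ[X] →ₗ[ℂ] ℂ) (hw : ∀ n, 1 ≤ n → w (P n) = 0) :
    ∃ a : ℂ, ∀ f, w f = a * u₀ f := by
  have h0 : u₀ (P 0) ≠ 0 := by simpa using h.regular₀ 0
  refine ⟨w (P 0) / u₀ (P 0), fun f => ?_⟩
  have := h.monic.functional_eq_zero (w - (w (P 0) / u₀ (P 0)) • u₀) (fun n => ?_) f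
  · simpa [sub_eq_zero] using this
  · rcases Nat.eq_zero_or_pos n with rfl | hn
    · simp [h0]
    · have h1 : u₀ (P n) = 0 := by simpa using h.ortho₀ 0 n (by omega)
      simp [hw n hn, h1]

/-- Since `u₁ (P 1) ≠ 0`, subtracting a multiple of `u₁` kills the value at `P 1` and reduces to the
one-term case. -/
lemma IsOrthogonalPair.exists_eq_smul_add_smul {u₀ u₁ : ℂ[X] →ₗ[ℂ] ℂ} {P : ℕ → ℂ[X]}
    (h : IsOrthogonalPair u₀ u₁ P) (w : ℂ[X] →ₗ[ℂ] ℂ) (hw : ∀ n, 2 ≤ n → w (P n) = 0) :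
    ∃ a b : ℂ, ∀ f, w f = a * u₀ f + b * u₁ f := by
  have h1 : u₁ (P 1) ≠ 0 := by simpa using h.regular₁ 0
  obtain ⟨a, ha⟩ := h.exists_eq_smul (w - (w (P 1) / u₁ (P 1)) • u₁) (fun n hn => by
    rcases hn.eq_or_lt with rfl | hn
    · simp [h1]
    · have h2 : u₁ (P n) = 0 := by simpa using h.ortho₁ 0 n (by omega)
      simp [hw n hn, h2])
  refine ⟨a, w (P 1) / u₁ (P 1), fun f => ?_⟩
  have := ha f
  simp only [LinearMap.sub_apply, LinearMap.smul_apply, smul_eq_mul] at this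
  linear_combination this

/-! ### Orthogonality of derivatives from Pearson-type relations -/

lemma IsMonicSequence.derivativeSequence {P : ℕ → ℂ[X]} (hP : IsMonicSequence P) :
    IsMonicSequence (derivativeSequence P) := by
  intro n
  have hn : ((n : ℂ) + 1) ≠ 0 := Nat.cast_add_one_ne_zero n
  have hle : (TwoOrthogonal.derivativeSequence P n).natDegree ≤ n := by
    refine (natDegree_C_mul_le _ _).trans ((natDegree_derivative_le _).trans ?_)
    rw [(hP (n + 1)).2]; simp
  have hc : (TwoOrthogonal.derivativeSequence P n).coeff n = 1 := by
    have h1 := (hP (n + 1)).1.coeff_natDegree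
    rw [(hP (n + 1)).2] at h1
    rw [TwoOrthogonal.derivativeSequence, coeff_C_mul, coeff_derivative, h1]
    field_simp
  exact ⟨monic_of_natDegree_le_of_coeff_eq_one n hle hc,
    natDegree_eq_of_le_of_coeff_ne_zero hle (by simp [hc])⟩

lemma functional_derivativeSequence (w : ℂ[X] →ₗ[ℂ] ℂ) (P : ℕ → ℂ[X]) (l n : ℕ) :
    w (X ^ l * derivativeSequence P n)
      = 1 / ((n : ℂ) + 1) * w (X ^ l * derivative (P (n + 1))) := by
  rw [derivativeSequence, mul_left_comm, ← smul_eq_C_mul, map_smul, smul_eq_mul]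

/-- A Pearson-type criterion for the 2-orthogonality of the sequence of derivatives. -/
lemma IsOrthogonalPair.derivativeSequence {u₀ u₁ : ℂ[X] →ₗ[ℂ] ℂ} {P : ℕ → ℂ[X]}
    (h : IsOrthogonalPair u₀ u₁ P) {w₀ w₁ : ℂ[X] →ₗ[ℂ] ℂ} {a₀ b₀ a₁ b₁ : ℕ → ℂ}
    (ha₀ : ∀ l, a₀ l ≠ 0) (ha₁ : ∀ l, a₁ l ≠ 0)
    (h₀ : ∀ l g, w₀ (X ^ l * derivative g) = a₀ l * u₁ (X ^ l * g) + b₀ l * u₀ (X ^ l * g))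
    (h₁ : ∀ l g, w₁ (X ^ l * derivative g)
      = a₁ l * u₀ (X ^ (l + 1) * g) + b₁ l * u₁ (X ^ l * g)) :
    IsOrthogonalPair w₀ w₁ (derivativeSequence P) where
  monic := h.monic.derivativeSequence
  ortho₀ k n hn := by
    rw [functional_derivativeSequence, h₀, h.ortho₁ _ _ (by omega), h.ortho₀ _ _ (by omega)]
    simp
  regular₀ k := by
    have hk : (((2 * k : ℕ) : ℂ) + 1) ≠ 0 := Nat.cast_add_one_ne_zero _
    -- At the critical index the `b₀` term just vanishes, and the `a₀` term is a regularity value of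
    -- `u₁`.
    rw [functional_derivativeSequence, h₀, h.ortho₀ k (2 * k + 1) le_rfl, mul_zero, add_zero]
    exact mul_ne_zero (one_div_ne_zero hk) (mul_ne_zero (ha₀ k) (h.regular₁ k))
  ortho₁ k n hn := by
    rw [functional_derivativeSequence, h₁, h.ortho₁ _ _ (by omega), h.ortho₀ _ _ (by omega)]
    simp
  regular₁ k := by
    have hk : (((2 * k + 1 : ℕ) : ℂ) + 1) ≠ 0 := Nat.cast_add_one_ne_zero _
    rw [functional_derivativeSequence, h₁, h.ortho₁ k (2 * k + 1 + 1) le_rfl, mul_zero, add_zero]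
    exact mul_ne_zero (one_div_ne_zero hk) (mul_ne_zero (ha₁ k) (h.regular₀ (k + 1)))

/-! ### Orthogonality of the cubic components -/

/-- The functional `f ↦ u (xᵏ f(x³))`. -/
noncomputable def cubicFunctional (u : ℂ[X] →ₗ[ℂ] ℂ) (k : ℕ) : ℂ[X] →ₗ[ℂ] ℂ :=
  u ∘ₗ LinearMap.mulLeft ℂ (X ^ k) ∘ₗ (expand ℂ 3).toLinearMap

lemma cubicFunctional_apply (u : ℂ[X] →ₗ[ℂ] ℂ) (k : ℕ) (f : ℂ[X]) :
    cubicFunctional u k f = u (X ^ k * f.comp (X ^ 3)) := by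
  simp [cubicFunctional, expand_eq_comp_X_pow]

/-- The functional `f ↦ u (xᵏ f)`. -/
noncomputable def powMulFunctional (u : ℂ[X] →ₗ[ℂ] ℂ) (k : ℕ) : ℂ[X] →ₗ[ℂ] ℂ :=
  u ∘ₗ LinearMap.mulLeft ℂ (X ^ k)

lemma powMulFunctional_apply (u : ℂ[X] →ₗ[ℂ] ℂ) (k : ℕ) (f : ℂ[X]) :
    powMulFunctional u k f = u (X ^ k * f) := rfl

lemma natDegree_X_pow_mul_comp (k : ℕ) {f : ℂ[X]} (hf : f ≠ 0) :
    (X ^ k * f.comp (X ^ 3)).natDegree = k + 3 * f.natDegree := by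
  have h : f.comp (X ^ 3) ≠ 0 := by
    rw [← expand_eq_comp_X_pow]
    exact (expand_ne_zero (by norm_num)).2 hf
  rw [natDegree_mul (pow_ne_zero _ X_ne_zero) h, natDegree_comp]
  simp [mul_comm]

lemma IsCubicDecomposition.isMonicSequence {P : ℕ → ℂ[X]} {R : Fin 3 → ℕ → ℂ[X]}
    (hR : IsCubicDecomposition P R) (hP : IsMonicSequence P) (k : Fin 3) :
    IsMonicSequence (R k) := by
  intro n
  obtain ⟨h1, h2⟩ := hP (3 * n + k)
  rw [hR k n] at h1 h2
  have h0 : R k n ≠ 0 := by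
    intro h
    rw [h] at h1
    simp at h1
  rw [natDegree_X_pow_mul_comp _ h0] at h2
  refine ⟨?_, by omega⟩
  rw [Monic, leadingCoeff_mul, leadingCoeff_comp (by simp)] at h1
  simp only [leadingCoeff_X_pow, one_pow, mul_one, one_mul] at h1
  exact h1

/-- The cubic component of index 0 of a 2-orthogonal sequence is 2-orthogonal. -/
lemma IsOrthogonalPair.cubic₀ {u₀ u₁ : ℂ[X] →ₗ[ℂ] ℂ} {P : ℕ → ℂ[X]} {R : Fin 3 → ℕ → ℂ[X]}
    (h : IsOrthogonalPair u₀ u₁ P) (hR : IsCubicDecomposition P R) :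
    IsOrthogonalPair (cubicFunctional u₀ 0) (cubicFunctional u₁ 1) (R 0) := by
  have e₀ : ∀ l n, cubicFunctional u₀ 0 (X ^ l * R 0 n) = u₀ (X ^ (3 * l) * P (3 * n)) := by
    intro l n
    have := hR 0 n
    simp only [Fin.val_zero, add_zero, pow_zero, one_mul] at this
    rw [cubicFunctional_apply, this]
    congr 1
    simp [pow_mul]
  have e₁ : ∀ l n, cubicFunctional u₁ 1 (X ^ l * R 0 n) = u₁ (X ^ (3 * l + 1) * P (3 * n)) := by
    intro l n
    have := hR 0 n
    simp only [Fin.val_zero, add_zero, pow_zero, one_mul] at this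
    rw [cubicFunctional_apply, this]
    congr 1
    simp
    ring
  refine ⟨hR.isMonicSequence h.monic 0, fun k n hn => ?_, fun k => ?_, fun k n hn => ?_,
    fun k => ?_⟩
  · rw [e₀]; exact h.ortho₀ _ _ (by omega)
  · rw [e₀, show 3 * (2 * k) = 2 * (3 * k) by ring]; exact h.regular₀ _
  · rw [e₁]; exact h.ortho₁ _ _ (by omega)
  · rw [e₁, show 3 * (2 * k + 1) = 2 * (3 * k + 1) + 1 by ring]; exact h.regular₁ _

/-- The factor x in P_{3n+1} supplies the x built into U₁, so `u₁` now plays the first role; U₀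
gains a factor x = (x^{1/3})³ to keep the regularity indices aligned. -/
lemma IsOrthogonalPair.cubic₁ {u₀ u₁ : ℂ[X] →ₗ[ℂ] ℂ} {P : ℕ → ℂ[X]} {R : Fin 3 → ℕ → ℂ[X]}
    (h : IsOrthogonalPair u₀ u₁ P) (hR : IsCubicDecomposition P R) :
    IsOrthogonalPair (cubicFunctional u₁ 1) (powMulFunctional (cubicFunctional u₀ 0) 1)
      (R 1) := by
  have e₀ : ∀ l n, cubicFunctional u₁ 1 (X ^ l * R 1 n) = u₁ (X ^ (3 * l) * P (3 * n + 1)) := by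
    intro l n
    have := hR 1 n
    simp only [Fin.val_one, pow_one] at this
    rw [cubicFunctional_apply, this]
    congr 1
    simp
    ring
  have e₁ : ∀ l n, powMulFunctional (cubicFunctional u₀ 0) 1 (X ^ l * R 1 n)
      = u₀ (X ^ (3 * l + 2) * P (3 * n + 1)) := by
    intro l n
    have := hR 1 n
    simp only [Fin.val_one, pow_one] at this
    rw [powMulFunctional_apply, cubicFunctional_apply, this]
    congr 1
    simp
    ring
  refine ⟨hR.isMonicSequence h.monic 1, fun k n hn => ?_, fun k => ?_, fun k n hn => ?_,
    fun k => ?_⟩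
  · rw [e₀]; exact h.ortho₁ _ _ (by omega)
  · rw [e₀, show 3 * (2 * k) = 2 * (3 * k) by ring]; exact h.regular₁ _
  · rw [e₁]; exact h.ortho₀ _ _ (by omega)
  · rw [e₁, show 3 * (2 * k + 1) + 1 = 2 * (3 * k + 2) by ring]; exact h.regular₀ _

lemma IsOrthogonalPair.cubic₂ {u₀ u₁ : ℂ[X] →ₗ[ℂ] ℂ} {P : ℕ → ℂ[X]} {R : Fin 3 → ℕ → ℂ[X]}
    (h : IsOrthogonalPair u₀ u₁ P) (hR : IsCubicDecomposition P R) :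
    IsOrthogonalPair (powMulFunctional (cubicFunctional u₀ 0) 1)
      (powMulFunctional (cubicFunctional u₁ 1) 1) (R 2) := by
  have e₀ : ∀ l n, powMulFunctional (cubicFunctional u₀ 0) 1 (X ^ l * R 2 n)
      = u₀ (X ^ (3 * l + 1) * P (3 * n + 2)) := by
    intro l n
    have := hR 2 n
    simp only [Fin.val_two] at this
    rw [powMulFunctional_apply, cubicFunctional_apply, this]
    congr 1
    simp
    ring
  have e₁ : ∀ l n, powMulFunctional (cubicFunctional u₁ 1) 1 (X ^ l * R 2 n)
      = u₁ (X ^ (3 * l + 2) * P (3 * n + 2)) := by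
    intro l n
    have := hR 2 n
    simp only [Fin.val_two] at this
    rw [powMulFunctional_apply, cubicFunctional_apply, this]
    congr 1
    simp
    ring
  refine ⟨hR.isMonicSequence h.monic 2, fun k n hn => ?_, fun k => ?_, fun k n hn => ?_,
    fun k => ?_⟩
  · rw [e₀]; exact h.ortho₀ _ _ (by omega)
  · rw [e₀, show 3 * (2 * k) + 2 = 2 * (3 * k + 1) by ring]; exact h.regular₀ _
  · rw [e₁]; exact h.ortho₁ _ _ (by omega)
  · rw [e₁, show 3 * (2 * k + 1) + 2 = 2 * (3 * k + 2) + 1 by ring]; exact h.regular₁ _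

/-! ### Pearson system for the component functionals -/

lemma derivative_comp_X_pow_three (f : ℂ[X]) :
    derivative (f.comp (X ^ 3)) = C 3 * (X ^ 2 * (derivative f).comp (X ^ 3)) := by
  rw [derivative_comp, derivative_X_pow]
  norm_num [mul_assoc]

/-- Turns differentiation in x into differentiation in x³; used with j = 0 for `v₀` and j = 1 for
`v₁`. -/
lemma derivative_X_pow_mul_comp (j l : ℕ) (g : ℂ[X]) :
    derivative (X ^ (j + 1) * (X ^ l * g).comp (X ^ 3))
      = C (3 * (l : ℂ) + j + 1) * (X ^ j * (X ^ l * g).comp (X ^ 3))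
        + C 3 * (X ^ j * (X ^ (l + 1) * derivative g).comp (X ^ 3)) := by
  have h : X ^ (j + 1) * (X ^ l * g).comp (X ^ 3)
      = (X ^ (3 * l + j + 1) : ℂ[X]) * g.comp (X ^ 3) := by
    rw [mul_comp, X_pow_comp]
    ring
  rw [h, derivative_mul, derivative_X_pow_succ, derivative_comp_X_pow_three, mul_comp, mul_comp,
    X_pow_comp, X_pow_comp]
  simp only [Nat.cast_add, Nat.cast_mul, Nat.cast_ofNat]
  ring

/-- The Pearson-type system satisfied by the functionals of the cubic components. -/
lemma exists_pearson {u₀ u₁ v₀ v₁ : ℂ[X] →ₗ[ℂ] ℂ} {P : ℕ → ℂ[X]} {R : Fin 3 → ℕ → ℂ[X]}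
    (h : IsOrthogonalPair u₀ u₁ P) (h' : IsOrthogonalPair v₀ v₁ (derivativeSequence P))
    (hR : IsCubicDecomposition P R) :
    ∃ a₀ b₀ a₁ b₁ : ℕ → ℂ, (∀ l, a₀ l ≠ 0) ∧ (∀ l, a₁ l ≠ 0) ∧
      (∀ l g, cubicFunctional v₀ 0 (X ^ (l + 1) * derivative g)
        = a₀ l * cubicFunctional u₁ 1 (X ^ l * g) + b₀ l * cubicFunctional u₀ 0 (X ^ l * g)) ∧
      (∀ l g, cubicFunctional v₁ 1 (X ^ (l + 1) * derivative g)
        = a₁ l * cubicFunctional u₀ 0 (X ^ (l + 1) * g)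
          + b₁ l * cubicFunctional u₁ 1 (X ^ l * g)) := by
  have hc₀ := h.cubic₀ hR
  have hc₁ := h.cubic₁ hR
  have hc₂ := h.cubic₂ hR
  have hR0 : ∀ n, P (3 * n) = (R 0 n).comp (X ^ 3) := fun n => by simpa using hR 0 n
  have hR1 : ∀ n, P (3 * n + 1) = X * (R 1 n).comp (X ^ 3) := fun n => by simpa using hR 1 n
  have hR2 : ∀ n, P (3 * n + 2) = X ^ 2 * (R 2 n).comp (X ^ 3) := fun n => by simpa using hR 2 n
  have hd : ∀ (v : ℂ[X] →ₗ[ℂ] ℂ) (l n : ℕ), v (X ^ l * derivative (P (n + 1)))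
      = ((n : ℂ) + 1) * v (X ^ l * derivativeSequence P n) := fun v l n => by
    have hn : ((n : ℂ) + 1) ≠ 0 := Nat.cast_add_one_ne_zero n
    rw [functional_derivativeSequence]
    field_simp
  have hv₀ : ∀ l n, 2 * l + 2 ≤ n → v₀ (X ^ l * derivative (P n)) = 0 := fun l n hn => by
    obtain ⟨n, rfl⟩ : ∃ m, n = m + 1 := ⟨n - 1, by omega⟩
    rw [hd, h'.ortho₀ _ _ (by omega), mul_zero]
  have hv₁ : ∀ l n, 2 * l + 3 ≤ n → v₁ (X ^ l * derivative (P n)) = 0 := fun l n hn => by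
    obtain ⟨n, rfl⟩ : ∃ m, n = m + 1 := ⟨n - 1, by omega⟩
    rw [hd, h'.ortho₁ _ _ (by omega), mul_zero]
  -- f ↦ v₀((x f(x³))') sends R₁ₙ to v₀(P'_{3n+1}) = 0 for n ≥ 1, hence is a multiple of U₁.
  obtain ⟨b, hb⟩ := hc₁.exists_eq_smul (cubicFunctional (v₀ ∘ₗ derivative) 1) (fun n hn => by
    rw [cubicFunctional_apply, pow_one, ← hR1]
    simpa using hv₀ 0 (3 * n + 1) (by omega))
  obtain ⟨d, hd'⟩ := hc₂.exists_eq_smul (cubicFunctional (v₁ ∘ₗ derivative) 2) (fun n hn => by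
    rw [cubicFunctional_apply, ← hR2]
    simpa using hv₁ 0 (3 * n + 2) (by omega))
  -- Write v₀(P_{3n}) = v₀((x P_{3n})') − v₀(x P'_{3n}); both terms vanish for n ≥ 2, the first
  -- because it is b U₁(R₀ₙ).
  obtain ⟨α, β, hαβ⟩ := hc₀.exists_eq_smul_add_smul (cubicFunctional v₀ 0) (fun n hn => by
    have h1 := hb (R 0 n)
    have h2 : cubicFunctional u₁ 1 (R 0 n) = 0 := by simpa using hc₀.ortho₁ 0 n (by omega)
    have h3 := hv₀ 1 (3 * n) (by omega)
    rw [h2, cubicFunctional_apply, ← hR0, LinearMap.comp_apply, pow_one, derivative_mul,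
      derivative_X, one_mul, map_add] at h1
    rw [pow_one] at h3
    rw [cubicFunctional_apply, ← hR0, pow_zero, one_mul]
    linear_combination h1 - h3)
  obtain ⟨ε, δ, hεδ⟩ := hc₁.exists_eq_smul_add_smul (cubicFunctional v₁ 1) (fun n hn => by
    have h1 := hd' (R 1 n)
    have h2 : powMulFunctional (cubicFunctional u₀ 0) 1 (R 1 n) = 0 := by
      simpa using hc₁.ortho₁ 0 n (by omega)
    have h3 := hv₁ 1 (3 * n + 1) (by omega)
    rw [h2, cubicFunctional_apply, LinearMap.comp_apply,
      show X ^ 2 * (R 1 n).comp (X ^ 3) = X * P (3 * n + 1) by rw [hR1]; ring, derivative_mul,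
      derivative_X, one_mul, map_add] at h1
    rw [pow_one] at h3
    rw [cubicFunctional_apply, pow_one, ← hR1]
    linear_combination h1 - h3)
  have hthree : (3 : ℂ) ≠ 0 := by norm_num
  -- Expand v₀((x f(x³))') for f = x^l g by the product rule and eliminate V₀(f) using `hαβ`.
  have e₀ : ∀ (l : ℕ) (g : ℂ[X]), 3 * cubicFunctional v₀ 0 (X ^ (l + 1) * derivative g)
      = (b - (3 * l + 1) * β) * cubicFunctional u₁ 1 (X ^ l * g)
        + (-(3 * l + 1) * α) * cubicFunctional u₀ 0 (X ^ l * g) := by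
    intro l g
    have h1 := hb (X ^ l * g)
    have h2 := hαβ (X ^ l * g)
    have h3 : cubicFunctional (v₀ ∘ₗ derivative) 1 (X ^ l * g)
        = (3 * l + 1) * cubicFunctional v₀ 0 (X ^ l * g)
          + 3 * cubicFunctional v₀ 0 (X ^ (l + 1) * derivative g) := by
      rw [cubicFunctional_apply, LinearMap.comp_apply, derivative_X_pow_mul_comp, map_add,
        ← smul_eq_C_mul, ← smul_eq_C_mul, map_smul, map_smul, cubicFunctional_apply,
        cubicFunctional_apply]
      simp
    linear_combination h1 - h3 - (3 * l + 1) * h2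
  have e₁ : ∀ (l : ℕ) (g : ℂ[X]), 3 * cubicFunctional v₁ 1 (X ^ (l + 1) * derivative g)
      = (d - (3 * l + 2) * δ) * cubicFunctional u₀ 0 (X ^ (l + 1) * g)
        + (-(3 * l + 2) * ε) * cubicFunctional u₁ 1 (X ^ l * g) := by
    intro l g
    have h1 := hd' (X ^ l * g)
    have h2 := hεδ (X ^ l * g)
    have h3 : cubicFunctional (v₁ ∘ₗ derivative) 2 (X ^ l * g)
        = (3 * l + 2) * cubicFunctional v₁ 1 (X ^ l * g)
          + 3 * cubicFunctional v₁ 1 (X ^ (l + 1) * derivative g) := by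
      rw [cubicFunctional_apply, LinearMap.comp_apply, derivative_X_pow_mul_comp, map_add,
        ← smul_eq_C_mul, ← smul_eq_C_mul, map_smul, map_smul, cubicFunctional_apply,
        cubicFunctional_apply, smul_eq_mul, smul_eq_mul]
      push_cast
      ring
    have h4 : powMulFunctional (cubicFunctional u₀ 0) 1 (X ^ l * g)
        = cubicFunctional u₀ 0 (X ^ (l + 1) * g) := by
      rw [powMulFunctional_apply, pow_one, ← mul_assoc, pow_succ']
    rw [h4] at h1 h2
    linear_combination h1 - h3 - (3 * l + 2) * h2
  refine ⟨fun l => (b - (3 * l + 1) * β) / 3, fun l => (-(3 * l + 1) * α) / 3,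
    fun l => (d - (3 * l + 2) * δ) / 3, fun l => (-(3 * l + 2) * ε) / 3,
    fun l => div_ne_zero (fun h0 => ?_) hthree, fun l => div_ne_zero (fun h0 => ?_) hthree,
    fun l g => ?_, fun l g => ?_⟩
  -- Test at g = R₀,₂ₗ₊₁, where the U₀ term drops out: a zero coefficient would give v₀(x^{3l+1}
  -- P'_{6l+3}) = 0, against the regularity of `v₀` at k = 3l+1.
  · have h1 := e₀ l (R 0 (2 * l + 1))
    rw [h0, hc₀.ortho₀ _ _ (by omega), zero_mul, mul_zero, add_zero, cubicFunctional_apply] at h1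
    have h2 := hd v₀ (3 * l + 1) (6 * l + 2)
    have h3 : v₀ (X ^ (3 * l + 1) * derivative (P (6 * l + 2 + 1))) = 0 := by
      rw [← h1, show 6 * l + 2 + 1 = 3 * (2 * l + 1) by ring, hR0, derivative_comp_X_pow_three,
        ← smul_eq_mul (a := (3 : ℂ)), ← map_smul, smul_eq_C_mul, mul_comp, X_pow_comp]
      refine congrArg v₀ ?_
      ring
    rw [h3] at h2
    have h4 : ((6 * l + 2 : ℕ) : ℂ) + 1 ≠ 0 := Nat.cast_add_one_ne_zero _
    refine mul_ne_zero h4 ?_ h2.symm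
    rw [show 6 * l + 2 = 2 * (3 * l + 1) by ring]
    exact h'.regular₀ _
  -- Same test for `v₁`: here the U₁ term drops out and regularity is contradicted at k = 3l+2.
  · have h1 := e₁ l (R 0 (2 * l + 2))
    rw [h0, hc₀.ortho₁ _ _ (by omega), zero_mul, mul_zero, add_zero, cubicFunctional_apply] at h1
    have h2 := hd v₁ (3 * l + 2) (6 * l + 5)
    have h3 : v₁ (X ^ (3 * l + 2) * derivative (P (6 * l + 5 + 1))) = 0 := by
      rw [← h1, show 6 * l + 5 + 1 = 3 * (2 * l + 2) by ring, hR0, derivative_comp_X_pow_three,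
        ← smul_eq_mul (a := (3 : ℂ)), ← map_smul, smul_eq_C_mul, mul_comp, X_pow_comp]
      refine congrArg v₁ ?_
      ring
    rw [h3] at h2
    have h4 : ((6 * l + 5 : ℕ) : ℂ) + 1 ≠ 0 := Nat.cast_add_one_ne_zero _
    refine mul_ne_zero h4 ?_ h2.symm
    rw [show 6 * l + 5 = 2 * (3 * l + 2) + 1 by ring]
    exact h'.regular₁ _
  · linear_combination (1 / 3) * e₀ l g
  · linear_combination (1 / 3) * e₁ l g

/-- The cubic components of a Hahn-classical sequence are Hahn-classical. -/
theorem IsHahnClassical.cubicComponent {P : ℕ → ℂ[X]} {R : Fin 3 → ℕ → ℂ[X]}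
    (hP : IsHahnClassical P) (hR : IsCubicDecomposition P R) (k : Fin 3) :
    IsHahnClassical (R k) := by
  obtain ⟨u₀, u₁, h⟩ := (isTwoOrthogonal_iff_exists_pair _).1 hP.1
  obtain ⟨v₀, v₁, h'⟩ := (isTwoOrthogonal_iff_exists_pair _).1 hP.2
  obtain ⟨a₀, b₀, a₁, b₁, ha₀, ha₁, e₀, e₁⟩ := exists_pearson h h' hR
  have key : ∀ {k : Fin 3} {u v w z : ℂ[X] →ₗ[ℂ] ℂ}, IsOrthogonalPair u v (R k) →
      IsOrthogonalPair w z (derivativeSequence (R k)) → IsHahnClassical (R k) :=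
    fun h h' => ⟨(isTwoOrthogonal_iff_exists_pair _).2 ⟨_, _, h⟩,
      (isTwoOrthogonal_iff_exists_pair _).2 ⟨_, _, h'⟩⟩
  have hX : ∀ (w : ℂ[X] →ₗ[ℂ] ℂ) (j l : ℕ) (g : ℂ[X]),
      powMulFunctional w j (X ^ l * g) = w (X ^ (l + j) * g) := fun w j l g => by
    rw [powMulFunctional_apply, ← mul_assoc, ← pow_add, add_comm]
  fin_cases k
  · exact key (h.cubic₀ hR) ((h.cubic₀ hR).derivativeSequence
      (w₀ := powMulFunctional (cubicFunctional v₀ 0) 1)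
      (w₁ := powMulFunctional (cubicFunctional v₁ 1) 1) ha₀ ha₁
      (fun l g => by rw [hX, e₀]) (fun l g => by rw [hX, e₁]))
  -- The pair (U₁, xU₀) reverses the roles: xV₁ comes first, then x²V₀, whose extra x shifts l by
  -- one in the relation for V₀.
  · exact key (h.cubic₁ hR) ((h.cubic₁ hR).derivativeSequence
      (w₀ := powMulFunctional (cubicFunctional v₁ 1) 1)
      (w₁ := powMulFunctional (cubicFunctional v₀ 0) 2) ha₁ (fun l => ha₀ (l + 1))
      (fun l g => by rw [hX, hX, e₁])
      (fun l g => by rw [hX, hX, show l + 2 = l + 1 + 1 from rfl, e₀]))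
  · exact key (h.cubic₂ hR) ((h.cubic₂ hR).derivativeSequence
      (w₀ := powMulFunctional (cubicFunctional v₀ 0) 2)
      (w₁ := powMulFunctional (cubicFunctional v₁ 1) 2) (fun l => ha₀ (l + 1))
      (fun l => ha₁ (l + 1))
      (fun l g => by rw [hX, hX, hX, show l + 2 = l + 1 + 1 from rfl, e₀])
      (fun l g => by rw [hX, hX, hX, show l + 2 = l + 1 + 1 from rfl, e₁]))

/-! ### Cubic decomposition from 3-fold symmetry -/

/-- Comparing coefficients in Pₙ(ωx) = ωⁿPₙ(x) gives (ωⁱ − ωⁿ)·coeff = 0, and ω is a primitive cube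
root of unity. -/
lemma IsThreefoldSymmetric.coeff_eq_zero {P : ℕ → ℂ[X]} (hP : IsThreefoldSymmetric P)
    {n i : ℕ} (hi : i % 3 ≠ n % 3) : (P n).coeff i = 0 := by
  set ω : ℂ := Complex.exp (2 * Real.pi * Complex.I / 3) with hω
  have hprim : IsPrimitiveRoot ω 3 := by
    simpa using Complex.isPrimitiveRoot_exp 3 (by norm_num)
  have hpow : Complex.exp (2 * n * Real.pi * Complex.I / 3) = ω ^ n := by
    rw [hω, ← Complex.exp_nat_mul]
    congr 1
    ring
  have hpoly : (P n).comp (C ω * X) = C (ω ^ n) * P n := by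
    refine Polynomial.funext fun x => ?_
    have := (hP n x).1
    rw [hpow] at this
    simpa using this
  have hcoeff := congrArg (fun p => p.coeff i) hpoly
  simp only [comp_C_mul_X_coeff, coeff_C_mul] at hcoeff
  have hne : ω ^ i - ω ^ n ≠ 0 := by
    rw [sub_ne_zero, ← pow_mod_orderOf ω i, ← pow_mod_orderOf ω n, ← hprim.eq_orderOf]
    exact fun h => hi (hprim.pow_inj (Nat.mod_lt _ (by norm_num)) (Nat.mod_lt _ (by norm_num)) h)
  refine (mul_eq_zero.1 (?_ : (ω ^ i - ω ^ n) * (P n).coeff i = 0)).resolve_left hne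
  linear_combination hcoeff

lemma IsThreefoldSymmetric.exists_cubicDecomposition {P : ℕ → ℂ[X]}
    (hP : IsThreefoldSymmetric P) : ∃ R, IsCubicDecomposition P R := by
  -- Shift coefficients down by k, then keep every third one; symmetry ensures that nothing nonzero
  -- is lost.
  refine ⟨fun k n => contract 3 (divX^[(k : ℕ)] (P (3 * n + k))), fun k n => ?_⟩
  have hdiv : ∀ (j : ℕ) (f : ℂ[X]) (i : ℕ), (divX^[j] f).coeff i = f.coeff (i + j) := by
    intro j
    induction j with
    | zero => simp
    | succ j ih =>
      intro f i
      rw [Function.iterate_succ_apply, ih, coeff_divX]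
      rfl
  have hk := k.isLt
  ext i
  rw [← expand_eq_comp_X_pow, coeff_X_pow_mul', coeff_expand (by norm_num)]
  split_ifs with h1 h2
  · rw [coeff_contract (by norm_num), hdiv]
    congr 1
    omega
  · exact hP.coeff_eq_zero (by omega)
  · exact hP.coeff_eq_zero (by omega)

end TwoOrthogonal

theorem mainTheorem12 (P : ℕ → ℂ[X])
    (hsymm : TwoOrthogonal.IsThreefoldSymmetric P) (hP : TwoOrthogonal.IsHahnClassical P) :
    (∃ R : Fin 3 → ℕ → ℂ[X], TwoOrthogonal.IsCubicDecomposition P R) ∧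
    ∀ R : Fin 3 → ℕ → ℂ[X], TwoOrthogonal.IsCubicDecomposition P R →
      ∀ k : Fin 3, TwoOrthogonal.IsHahnClassical (R k) :=
  ⟨hsymm.exists_cubicDecomposition, fun _ hR => hP.cubicComponent hR⟩
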